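/- Let $d,p\ge 0$ be integers and let $|\cdot|$ denote Euclidean norms and $\|\cdot\|$ the corresponding operator norm of $d\times p$ matrices. On a probability space let $(Z_k)_{k\in\mathbb Z}$ be i.i.d. random vectors in $\mathbb R^p$ ($Z$ denotes a generic one), and let $A_{k,j}$, $k,j\in\mathbb Z$, be random $d\times p$ matrices such that the sequence $(\mathbf A_k)_{k\in\mathbb Z}$, $\mathbf A_k=(A_{k,j})_{j\in\mathbb Z}$, is stationary and independent of $(Z_k)_{k\in\mathbb Z}$. Put $A_j=A_{0,j}$ and $$X_k=\sum_{j\in\mathbb Z}A_{k,j}Z_{k-j},\qquad k\in\mathbb Z .$$ Assume the following. (a) $Z$ is regularly varying with index $\alpha>0$ and limit measure $\mu$. That is, $\mu$ is a non-null measure on $\mathbb R^p\setminus\{0\}$ with $\mu\{|x|\ge r\}<\infty$ for all $r>0$; for every bounded continuous $f:\mathbb R^p\to\mathbb R$ vanishing in a neighbourhood of the origin, $\mathbb E f(u^{-1}Z)/P(|Z|>u)\to\int f\,d\mu$ as $u\to\infty$; and $\mu(uB)=u^{-\alpha}\mu(B)$ for all $u>0$ and all Borel $B\subset\mathbb R^p\setminus\{0\}$.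 If $\alpha>1$, then moreover $\mathbb EZ=0$. (b) There is $0<\varepsilon<\alpha$ such that - $\sum_j\mathbb E\|A_j\|^{\alpha-\varepsilon}<\infty$ and $\sum_j\mathbb E\|A_j\|^{\alpha+\varepsilon}<\infty$, if $\alpha\in(0,1)\cup(1,2)$; - $\mathbb E\big(\sum_j\|A_j\|^{\alpha-\varepsilon}\big)^{(\alpha+\varepsilon)/(\alpha-\varepsilon)}<\infty$, if $\alpha\in\{1,2\}$; - $\mathbb E\big(\sum_j\|A_j\|^{2}\big)^{(\alpha+\varepsilon)/2}<\infty$, if $\alpha>2$. (c) $(\gamma_n)_{n\ge1}$ is a sequence of positive numbers such that $(Z_1+\dots+Z_n)/\gamma_n\to0$ in probability; $\gamma_n/\sqrt{n^{1+\varepsilon'}}\to\infty$ for some $\varepsilon'>0$, if $\alpha=2$; and $\gamma_n/\sqrt{n\log n}\to\infty$, if $\alpha>2$. Let $r_n=1/\big(nP(|Z|>\gamma_n)\big)$. Then the following hold. 1. If $0<\alpha<1$, then for each $\delta>0$ $$\lim_{\varepsilon\downarrow0}\limsup_{n\to\infty} r_nP\Big(\sum_{k=1}^n|X_k|I\{|X_k|\le\gamma_n\varepsilon\}>\gamma_n\delta\Big)=0,$$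 and hence also, for each $\delta>0$, $$\lim_{\varepsilon\downarrow0}\limsup_{n\to\infty} r_nP\Big(\Big|\sum_{k=1}^nX_kI\{|X_k|\le\gamma_n\varepsilon\}\Big|>\gamma_n\delta\Big)=0.$$ 2. If $0<\alpha\le1$, then $$\mathbb E\Big(\sum_{j\in\mathbb Z}\|A_{j,j}\|\Big)^\alpha<\infty,$$ and hence also the sum $\sum_jA_{j,j}$ converges a.s. (unconditionally) and $$\mathbb E\sup_{J\subset\mathbb Z}\Big\|\sum_{j\in J}A_{j,j}\Big\|^\alpha<\infty,$$ where the supremum is measurable up to null sets. 3. If $0<\alpha\le1$, then for every $k$ the series defining $X_k$ converges absolutely a.s. -/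

import Mathlib

open MeasureTheory ProbabilityTheory Filter Topology
open scoped ENNReal Matrix.Norms.L2Operator

noncomputable section

namespace RandomCoefficientProcess

/-- `ℝᵐ` with its Euclidean norm. -/
abbrev Vec (m : ℕ) : Type := EuclideanSpace ℝ (Fin m)

/-- Real `d × p` matrices.  The scope `Matrix.Norms.L2Operator` opened above makes `‖M‖` the
operator norm of `M` with respect to the Euclidean norms (it induces the usual topology). -/
abbrev Mat (d p : ℕ) : Type := Matrix (Fin d) (Fin p) ℝ

/-- The Borel `σ`-algebra on matrices, i.e. the product `σ`-algebra of the entries. -/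
instance matMeasurableSpace (d p : ℕ) : MeasurableSpace (Mat d p) :=
  inferInstanceAs (MeasurableSpace (Fin d → Fin p → ℝ))

/-- The measures on `ℝᵐ ∖ {0}` (viewed as measures on `ℝᵐ` not charging the origin) that are finite
on `{|x| ≥ r}` for every `r > 0`.  Such a measure is automatically Radon on `ℝᵐ ∖ {0}`. -/
def IsM0 {m : ℕ} (μ : Measure (Vec m)) : Prop :=
  μ {0} = 0 ∧ ∀ r : ℝ, 0 < r → μ {x | r ≤ ‖x‖} < ⊤

/-- Convergence in `M₀(ℝᵐ)`: convergence of the integrals of all bounded continuous functions that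
vanish on some neighbourhood of the origin. -/
def TendstoM0 {m : ℕ} {ι : Type*} (ν : ι → Measure (Vec m)) (l : Filter ι)
    (μ : Measure (Vec m)) : Prop :=
  ∀ f : BoundedContinuousFunction (Vec m) ℝ, (∀ᶠ x in 𝓝 (0 : Vec m), f x = 0) →
    Tendsto (fun i => ∫ x, f x ∂(ν i)) l (𝓝 (∫ x, f x ∂μ))

variable {Ω : Type*} [MeasurableSpace Ω]

/-- `Z ∈ RV(μ, α)`: `Z` is regularly varying with non-null limit measure `μ` and index `α > 0`. -/
structure IsRegularlyVarying {m : ℕ} (P : Measure Ω) (Z : Ω → Vec m) (μ : Measure (Vec m))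
    (α : ℝ) : Prop where
  isM0 : IsM0 μ
  ne_zero : μ ≠ 0
  /-- `P(u⁻¹ Z ∈ ·) / P(|Z| > u) → μ` in `M₀` as `u → ∞`. -/
  tendsto : TendstoM0
    (fun u : ℝ => (P {ω | u < ‖Z ω‖})⁻¹ • P.map (fun ω => u⁻¹ • Z ω)) atTop μ
  index_pos : 0 < α
  /-- `μ(uB) = u^{-α} μ(B)` for all Borel sets `B ⊆ ℝᵐ ∖ {0}` and `u > 0`. -/
  homogeneous : ∀ u : ℝ, 0 < u → ∀ B : Set (Vec m), MeasurableSet B → B ⊆ {0}ᶜ →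
    μ ((fun x => u • x) '' B) = ENNReal.ofReal (u ^ (-α)) * μ B

/-- The moment conditions on a sequence `(A_j)` of random matrices, with a common `0 < ε < α`;
which one applies depends on `α`. -/
def MomentCondition {d p : ℕ} (P : Measure Ω) (A : ℤ → Ω → Mat d p) (α : ℝ) : Prop :=
  ∃ ε : ℝ, 0 < ε ∧ ε < α ∧
    (α ∈ Set.Ioo (0 : ℝ) 1 ∪ Set.Ioo (1 : ℝ) 2 →
      ∑' j, ∫⁻ ω, ‖A j ω‖ₑ ^ (α - ε) ∂P < ⊤ ∧ ∑' j, ∫⁻ ω, ‖A j ω‖ₑ ^ (α + ε) ∂P < ⊤) ∧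
    (α = 1 ∨ α = 2 →
      ∫⁻ ω, (∑' j, ‖A j ω‖ₑ ^ (α - ε)) ^ ((α + ε) / (α - ε)) ∂P < ⊤) ∧
    (2 < α →
      ∫⁻ ω, (∑' j, ‖A j ω‖ₑ ^ (2 : ℝ)) ^ ((α + ε) / 2) ∂P < ⊤)

/-- The assumptions on the normalizing sequence `(γ_n)_{n ≥ 1}` of positive numbers. -/
structure IsNormalizing {p : ℕ} (P : Measure Ω) (Z : ℤ → Ω → Vec p) (α : ℝ) (γ : ℕ → ℝ) :
    Prop where
  pos : ∀ n, 1 ≤ n → 0 < γ n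
  /-- `(Z_1 + ... + Z_n) / γ_n → 0` in probability. -/
  sum_tendsto : TendstoInMeasure P
    (fun (n : ℕ) ω => (γ n)⁻¹ • ∑ k ∈ Finset.Icc 1 n, Z (k : ℤ) ω) atTop (fun _ => 0)
  growth_eq_two : α = 2 → ∃ ε : ℝ, 0 < ε ∧
    Tendsto (fun n : ℕ => γ n / √((n : ℝ) ^ (1 + ε))) atTop atTop
  growth_gt_two : 2 < α →
    Tendsto (fun n : ℕ => γ n / √((n : ℝ) * Real.log n)) atTop atTop

/-- The standing assumptions on the coefficients `A k j = A_{k,j}` (`d × p` matrices), the noise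
`Z k = Z_k` (vectors in `ℝᵖ`), the limit measure `μ`, the index `α` and the normalization `γ`. -/
structure Hypotheses {d p : ℕ} (P : Measure Ω) (A : ℤ → ℤ → Ω → Mat d p) (Z : ℤ → Ω → Vec p)
    (μ : Measure (Vec p)) (α : ℝ) (γ : ℕ → ℝ) : Prop where
  measurable_A : ∀ k j, Measurable (A k j)
  measurable_Z : ∀ k, Measurable (Z k)
  /-- `(Z_k)` is i.i.d. -/
  iIndep_Z : iIndepFun Z P
  identDistrib_Z : ∀ k, IdentDistrib (Z k) (Z 0) P P
  /-- The sequence of sequences `((A_{k,j})_j)_k` is stationary. -/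
  stationary_A : ∀ h : ℤ,
    IdentDistrib (fun ω (k j : ℤ) => A (k + h) j ω) (fun ω (k j : ℤ) => A k j ω) P P
  /-- The coefficients are independent of the noise. -/
  indep_A_Z : IndepFun (fun ω (k j : ℤ) => A k j ω) (fun ω (k : ℤ) => Z k ω) P
  regularlyVarying : IsRegularlyVarying P (Z 0) μ α
  centered : 1 < α → ∫ ω, Z 0 ω ∂P = 0
  /-- By stationarity the choice of the time `0` is immaterial. -/
  moment : MomentCondition P (A 0) α
  normalizing : IsNormalizing P Z α γ

/-- The `j`-th term `A_{k,j} Z_{k-j}` of the series defining `X_k`. -/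
def term {d p : ℕ} (A : ℤ → ℤ → Ω → Mat d p) (Z : ℤ → Ω → Vec p) (k j : ℤ) (ω : Ω) : Vec d :=
  WithLp.toLp 2 ((A k j ω).mulVec (Z (k - j) ω).ofLp)

/-- `X_k = ∑_{j ∈ ℤ} A_{k,j} Z_{k-j}`. -/
def X {d p : ℕ} (A : ℤ → ℤ → Ω → Mat d p) (Z : ℤ → Ω → Vec p) (k : ℤ) (ω : Ω) : Vec d :=
  ∑' j : ℤ, term A Z k j ω

/-- `r_n = 1 / (n P(|Z| > γ_n))`. -/
def rate {p : ℕ} (P : Measure Ω) (Z : ℤ → Ω → Vec p) (γ : ℕ → ℝ) (n : ℕ) : ℝ≥0∞ :=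
  ((n : ℝ≥0∞) * P {ω | γ n < ‖Z 0 ω‖})⁻¹

/-- The truncation `x I{|x| ≤ b}`. -/
def truncate {d : ℕ} (b : ℝ) (x : Vec d) : Vec d :=
  {y : Vec d | ‖y‖ ≤ b}.indicator id x

/-- The small-jump condition: for each `δ > 0`,
`lim_{ε ↓ 0} limsup_n r_n P(|∑_{k=1}^n X_k I{|X_k| ≤ γ_n ε}| > γ_n δ) = 0`. -/
def SmallJump {d p : ℕ} (P : Measure Ω) (A : ℤ → ℤ → Ω → Mat d p) (Z : ℤ → Ω → Vec p)
    (γ : ℕ → ℝ) : Prop :=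
  ∀ δ : ℝ, 0 < δ → Tendsto (fun ε : ℝ => limsup (fun n : ℕ => rate P Z γ n *
      P {ω | γ n * δ < ‖∑ k ∈ Finset.Icc 1 n, truncate (γ n * ε) (X A Z (k : ℤ) ω)‖}) atTop)
    (𝓝[>] 0) (𝓝 0)

/-- The absolute small-jump condition: for each `δ > 0`,
`lim_{ε ↓ 0} limsup_n r_n P(∑_{k=1}^n |X_k| I{|X_k| ≤ γ_n ε} > γ_n δ) = 0`. -/
def AbsSmallJump {d p : ℕ} (P : Measure Ω) (A : ℤ → ℤ → Ω → Mat d p) (Z : ℤ → Ω → Vec p)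
    (γ : ℕ → ℝ) : Prop :=
  ∀ δ : ℝ, 0 < δ → Tendsto (fun ε : ℝ => limsup (fun n : ℕ => rate P Z γ n *
      P {ω | γ n * δ < ∑ k ∈ Finset.Icc 1 n, ‖truncate (γ n * ε) (X A Z (k : ℤ) ω)‖}) atTop)
    (𝓝[>] 0) (𝓝 0)

/-- `E (∑_j ‖A_{j,j}‖)^α < ∞`. -/
def AbsSummA {d p : ℕ} (P : Measure Ω) (A : ℤ → ℤ → Ω → Mat d p) (α : ℝ) : Prop :=
  ∫⁻ ω, (∑' j : ℤ, ‖A j j ω‖ₑ) ^ α ∂P < ⊤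

/-- `∑_j A_{j,j}` converges a.s. and `E sup_{J ⊆ ℤ} ‖∑_{j ∈ J} A_{j,j}‖^α < ∞`.  Since every subset
`J` is allowed, convergence is unconditional.  The supremum is over an uncountable family, so its
measurability (up to null sets) is part of the condition. -/
def SummA {d p : ℕ} (P : Measure Ω) (A : ℤ → ℤ → Ω → Mat d p) (α : ℝ) : Prop :=
  (∀ᵐ ω ∂P, Summable fun j : ℤ => A j j ω) ∧
  AEMeasurable (fun ω => ⨆ J : Set ℤ, ‖∑' j : J, A j j ω‖ₑ ^ α) P ∧
  ∫⁻ ω, ⨆ J : Set ℤ, ‖∑' j : J, A j j ω‖ₑ ^ α ∂P < ⊤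

end RandomCoefficientProcess

end

namespace RandomCoefficientProcess

/-! Only the scalar tail `P(|Z| > u)` matters. Testing the `M₀` limit against radial cutoffs and
using homogeneity shows that this tail varies regularly with index `-α`. Iterating the resulting
doubling estimates gives Potter's bounds (`IsRegularlyVarying.exists_tail_div_le`), which control
`P(a|Z| > u) / P(|Z| > u)` by `a^(α-η) + a^(α+η)` for all `a > 0` and all large `u`.

For `α < 1`, integrating this bound over levels below `uε` gives a Karamata estimate for `E
min(a|Z|, uε)`: it is at most a constant times `u P(|Z| > u) (a^(α-η) ε^(1-α+η) + a^(α+η)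
ε^(1-α-η))` (`IsRegularlyVarying.exists_lintegral_min_le`). The estimate is uniform in `a`, so `a`
may be replaced by the independent `‖A_{k,j}‖` and the result summed over `j` by the moment
condition. Since `x ↦ min(x, b)` is subadditive, the truncated `|X_k|` has mean at most `u P(|Z| >
u) K(ε)` with `K(ε) → 0`. Markov's inequality for `n` such terms at `u = γ_n` leaves exactly
`K(ε)/δ` after multiplication by `r_n`. The dependence between the `X_k` plays no role, because only
first moments enter. The estimate needs `γ_n → ∞`, which follows from `(Z_1 + ... + Z_n)/γ_n → 0`
because `Z` is unbounded (`IsNormalizing.tendsto_atTop`).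

For `α ≤ 1` the remaining claims use that `x ↦ x^β` is subadditive for `β ≤ 1`. The `β`-th moment of
a series of norms is then at most the sum of the `β`-th moments, and these depend only on the laws
of single coefficients, which stationarity moves to time `0`. Summability of the coefficients
`A_{j,j}` takes `β = α`; convergence of the series for `X_k` takes `β < α`, where `E|Z|^β < ∞`. -/

/-- A continuous function of the norm with `1{b ≤ ‖x‖} ≤ radialBump a b x ≤ 1{a < ‖x‖}`. -/
noncomputable def radialBump {m : ℕ} (a b : ℝ) : BoundedContinuousFunction (Vec m) ℝ :=
  BoundedContinuousFunction.ofNormedAddCommGroup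
    (fun x => max 0 (min 1 ((‖x‖ - a) / (b - a)))) (by fun_prop) 1 (fun x => by
      rw [Real.norm_of_nonneg (le_max_left _ _)]
      exact max_le zero_le_one (min_le_left _ _))

/-! ### Continuous radial cutoffs -/

section radialBump

variable {m : ℕ} {a b : ℝ}

theorem radialBump_apply (x : Vec m) :
    radialBump a b x = max 0 (min 1 ((‖x‖ - a) / (b - a))) := rfl

theorem radialBump_nonneg (x : Vec m) : 0 ≤ radialBump a b x := le_max_left _ _

theorem radialBump_le_one (x : Vec m) : radialBump a b x ≤ 1 :=
  max_le zero_le_one (min_le_left _ _)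

theorem radialBump_eq_zero (hab : a < b) {x : Vec m} (hx : ‖x‖ ≤ a) : radialBump a b x = 0 := by
  rw [radialBump_apply, max_eq_left]
  exact (min_le_right _ _).trans (div_nonpos_of_nonpos_of_nonneg (by linarith) (by linarith))

theorem radialBump_eq_one (hab : a < b) {x : Vec m} (hx : b ≤ ‖x‖) : radialBump a b x = 1 := by
  rw [radialBump_apply, min_eq_left, max_eq_right zero_le_one]
  rw [one_le_div (by linarith)]
  linarith

theorem radialBump_le_indicator (hab : a < b) (x : Vec m) :
    radialBump a b x ≤ {y : Vec m | a < ‖y‖}.indicator (fun _ => (1 : ℝ)) x := by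
  by_cases hx : a < ‖x‖
  · rw [Set.indicator_of_mem (by exact hx)]
    exact radialBump_le_one x
  · rw [radialBump_eq_zero hab (not_lt.1 hx)]
    exact Set.indicator_nonneg (fun _ _ => zero_le_one) _

theorem indicator_le_radialBump (hab : a < b) (x : Vec m) :
    {y : Vec m | b ≤ ‖y‖}.indicator (fun _ => (1 : ℝ)) x ≤ radialBump a b x := by
  by_cases hx : b ≤ ‖x‖
  · rw [radialBump_eq_one hab hx]
    exact Set.indicator_le_self' (fun _ _ => zero_le_one) _
  · rw [Set.indicator_of_notMem (by exact hx)]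
    exact radialBump_nonneg x

theorem radialBump_eventually_eq_zero (ha : 0 < a) (hab : a < b) :
    ∀ᶠ x in 𝓝 (0 : Vec m), radialBump a b x = 0 := by
  filter_upwards [Metric.ball_mem_nhds (0 : Vec m) ha] with x hx
  exact radialBump_eq_zero hab (mem_ball_zero_iff.1 hx).le

theorem integral_radialBump_le (μ : Measure (Vec m)) (hab : a < b)
    (hμ : μ {x | a ≤ ‖x‖} < ⊤) :
    ∫ x, radialBump a b x ∂μ ≤ μ.real {x | a ≤ ‖x‖} := by
  have hμ' : μ {x | a < ‖x‖} < ⊤ := 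
    (measure_mono (Set.ofPred_subset_ofPred.2 fun x hx => le_of_lt hx)).trans_lt hμ
  have hms : MeasurableSet {x : Vec m | a < ‖x‖} := measurableSet_lt measurable_const measurable_norm
  calc ∫ x, radialBump a b x ∂μ
      ≤ ∫ x, {y : Vec m | a < ‖y‖}.indicator (fun _ => (1 : ℝ)) x ∂μ :=
        integral_mono_of_nonneg (ae_of_all _ radialBump_nonneg)
          ((integrable_indicator_iff hms).2 (integrableOn_const hμ'.ne))
          (ae_of_all _ (radialBump_le_indicator hab))
    _ = μ.real {x | a < ‖x‖} := by
        rw [integral_indicator hms]; simp [Measure.real]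
    _ ≤ μ.real {x | a ≤ ‖x‖} := measureReal_mono (Set.ofPred_subset_ofPred.2 fun x hx => le_of_lt hx) hμ.ne

theorem integrable_radialBump (μ : Measure (Vec m)) (hab : a < b)
    (hμ : μ {x | a ≤ ‖x‖} < ⊤) : Integrable (radialBump a b) μ := by
  have hμ' : μ {x | a < ‖x‖} < ⊤ := 
    (measure_mono (Set.ofPred_subset_ofPred.2 fun x hx => le_of_lt hx)).trans_lt hμ
  have hms : MeasurableSet {x : Vec m | a < ‖x‖} := measurableSet_lt measurable_const measurable_norm
  refine Integrable.mono' ((integrable_indicator_iff hms).2 (integrableOn_const (C := (1 : ℝ)) hμ'.ne))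
    (radialBump a b).continuous.aestronglyMeasurable (ae_of_all _ fun x => ?_)
  rw [Real.norm_of_nonneg (radialBump_nonneg x)]
  exact radialBump_le_indicator hab x

theorem le_integral_radialBump (μ : Measure (Vec m)) (hab : a < b)
    (hμ : μ {x | a ≤ ‖x‖} < ⊤) :
    μ.real {x | b ≤ ‖x‖} ≤ ∫ x, radialBump a b x ∂μ := by
  have hms : MeasurableSet {x : Vec m | b ≤ ‖x‖} := measurableSet_le measurable_const measurable_norm
  calc μ.real {x | b ≤ ‖x‖}
      = ∫ x, {y : Vec m | b ≤ ‖y‖}.indicator (fun _ => (1 : ℝ)) x ∂μ := by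
        rw [integral_indicator hms]; simp [Measure.real]
    _ ≤ ∫ x, radialBump a b x ∂μ :=
        integral_mono_of_nonneg
          (ae_of_all _ fun x => Set.indicator_nonneg (fun _ _ => zero_le_one) _)
          (integrable_radialBump μ hab hμ) (ae_of_all _ (indicator_le_radialBump hab))

end radialBump

/-! ### Regular variation of the tail of the norm -/

section Tail

variable {Ω : Type*} [MeasurableSpace Ω] {P : Measure Ω} {m : ℕ}
  {Z : Ω → Vec m} {μ : Measure (Vec m)} {α : ℝ}

/-- The tail `P(|Z| > u)`. -/
noncomputable def tail (P : Measure Ω) (Z : Ω → Vec m) (u : ℝ) : ℝ := P.real {ω | u < ‖Z ω‖}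

theorem tail_nonneg (u : ℝ) : 0 ≤ tail P Z u := measureReal_nonneg

theorem IsRegularlyVarying.tendsto_radialBump (h : IsRegularlyVarying P Z μ α)
    (hZ : Measurable Z) {a b : ℝ} (ha : 0 < a) (hab : a < b) :
    Tendsto (fun u : ℝ => (∫ ω, radialBump a b (u⁻¹ • Z ω) ∂P) / tail P Z u) atTop
      (𝓝 (∫ x, radialBump a b x ∂μ)) := by
  refine (h.tendsto (radialBump a b) (radialBump_eventually_eq_zero ha hab)).congr fun u => ?_
  rw [integral_smul_measure, integral_map (by fun_prop)
    (radialBump a b).continuous.aestronglyMeasurable, ENNReal.toReal_inv, smul_eq_mul,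
    inv_mul_eq_div]
  rfl

theorem IsRegularlyVarying.measure_norm_ge (h : IsRegularlyVarying P Z μ α) {r : ℝ} (hr : 0 < r) :
    μ.real {x | r ≤ ‖x‖} = r ^ (-α) * μ.real {x | 1 ≤ ‖x‖} := by
  have hset : (fun x : Vec m => r • x) '' {x | 1 ≤ ‖x‖} = {x | r ≤ ‖x‖} := by
    ext x
    constructor
    · rintro ⟨y, hy, rfl⟩
      rw [Set.mem_ofPred_eq, norm_smul, Real.norm_of_nonneg hr.le]
      exact le_mul_of_one_le_right hr.le hy
    · intro hx
      refine ⟨r⁻¹ • x, ?_, smul_inv_smul₀ hr.ne' x⟩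
      rw [Set.mem_ofPred_eq, norm_smul, norm_inv, Real.norm_of_nonneg hr.le, inv_mul_eq_div,
        one_le_div hr]
      exact hx
  have := h.homogeneous r hr {x | 1 ≤ ‖x‖} (measurableSet_le measurable_const measurable_norm) (by
    intro x hx hx0
    rw [Set.mem_singleton_iff.1 hx0, Set.mem_ofPred_eq, norm_zero] at hx
    linarith)
  rw [hset] at this
  rw [Measure.real, this, ENNReal.toReal_mul, ENNReal.toReal_ofReal (by positivity)]
  rfl

/-- By homogeneity, if this set were null then so would be every `{‖x‖ ≥ r}` with `r > 0`; these
exhaust the complement of the origin, so `μ` would vanish. -/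
theorem IsRegularlyVarying.measure_norm_ge_one_pos (h : IsRegularlyVarying P Z μ α) :
    0 < μ.real {x | 1 ≤ ‖x‖} := by
  refine measureReal_nonneg.lt_of_ne fun h0 => h.ne_zero ?_
  have hz : ∀ n : ℕ, μ {x | 1 / ((n : ℝ) + 1) ≤ ‖x‖} = 0 := fun n => by
    have hn : 0 < 1 / ((n : ℝ) + 1) := by positivity
    have := h.measure_norm_ge hn
    rw [← h0, mul_zero] at this
    exact (measureReal_eq_zero_iff (h.isM0.2 _ hn).ne).1 this
  rw [← Measure.measure_univ_eq_zero]
  refine measure_mono_null ?_ (measure_union_null h.isM0.1 (measure_iUnion_null hz))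
  intro x _
  by_cases hx : x = 0
  · exact Or.inl hx
  · obtain ⟨n, hn⟩ := exists_nat_one_div_lt (norm_pos_iff.2 hx)
    exact Or.inr (Set.mem_iUnion.2 ⟨n, hn.le⟩)

variable [IsProbabilityMeasure P]

theorem tail_le_one (u : ℝ) : tail P Z u ≤ 1 := measureReal_le_one

theorem tail_antitone : Antitone (tail P Z) := fun _ _ huv =>
  measureReal_mono (fun _ hω => lt_of_le_of_lt huv hω)

theorem ofReal_tail (u : ℝ) : ENNReal.ofReal (tail P Z u) = P {ω | u < ‖Z ω‖} :=
  ofReal_measureReal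

theorem integral_radialBump_scaled_le (hZ : Measurable Z) {a b u : ℝ} (hab : a < b) (hu : 0 < u) :
    ∫ ω, radialBump a b (u⁻¹ • Z ω) ∂P ≤ tail P Z (a * u) := by
  have hms : MeasurableSet {ω | a * u < ‖Z ω‖} := measurableSet_lt measurable_const hZ.norm
  calc ∫ ω, radialBump a b (u⁻¹ • Z ω) ∂P
      ≤ ∫ ω, {ω | a * u < ‖Z ω‖}.indicator (fun _ => (1 : ℝ)) ω ∂P := by
        refine integral_mono_of_nonneg (ae_of_all _ fun _ => radialBump_nonneg _)
          ((integrable_const (1 : ℝ)).indicator hms) (ae_of_all _ fun ω => ?_)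
        refine (radialBump_le_indicator hab _).trans (le_of_eq ?_)
        have : a < ‖u⁻¹ • Z ω‖ ↔ a * u < ‖Z ω‖ := by
          rw [norm_smul, norm_inv, Real.norm_of_nonneg hu.le, inv_mul_eq_div, lt_div_iff₀ hu]
        simp only [Set.indicator_apply, Set.mem_ofPred_eq, this]
    _ = tail P Z (a * u) := by
        rw [integral_indicator hms]; simp [tail, Measure.real]

theorem le_integral_radialBump_scaled (hZ : Measurable Z) {a b u : ℝ} (hab : a < b) (hu : 0 < u) :
    tail P Z (b * u) ≤ ∫ ω, radialBump a b (u⁻¹ • Z ω) ∂P := by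
  have hms : MeasurableSet {ω | b * u < ‖Z ω‖} := measurableSet_lt measurable_const hZ.norm
  calc tail P Z (b * u) = ∫ ω, {ω | b * u < ‖Z ω‖}.indicator (fun _ => (1 : ℝ)) ω ∂P := by
        rw [integral_indicator hms]; simp [tail, Measure.real]
    _ ≤ ∫ ω, radialBump a b (u⁻¹ • Z ω) ∂P := by
        refine integral_mono_of_nonneg
          (ae_of_all _ fun ω => Set.indicator_nonneg (fun _ _ => zero_le_one) _) ?_
          (ae_of_all _ fun ω => ?_)
        · refine Integrable.mono' (integrable_const (1 : ℝ)) ?_ (ae_of_all _ fun ω => ?_)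
          · exact ((radialBump a b).continuous.measurable.comp
              (hZ.const_smul u⁻¹)).aestronglyMeasurable
          · rw [Real.norm_of_nonneg (radialBump_nonneg _)]
            exact radialBump_le_one _
        · by_cases hω : b * u < ‖Z ω‖
          · refine (Set.indicator_le_self' (fun _ _ => zero_le_one) _).trans_eq
              (radialBump_eq_one hab ?_).symm
            · rw [norm_smul, norm_inv, Real.norm_of_nonneg hu.le, inv_mul_eq_div, le_div_iff₀ hu]
              exact hω.le
          · rw [Set.indicator_of_notMem (by exact hω)]
            exact radialBump_nonneg _

theorem IsRegularlyVarying.tail_pos (h : IsRegularlyVarying P Z μ α) (hZ : Measurable Z) (u : ℝ) :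
    0 < tail P Z u := by
  refine (tail_nonneg u).lt_of_ne fun h0 => ?_
  have hab : (1 : ℝ) < 2 := by norm_num
  have hlim : Tendsto (fun v : ℝ => (∫ ω, radialBump 1 2 (v⁻¹ • Z ω) ∂P) / tail P Z v) atTop
      (𝓝 0) := by
    refine tendsto_const_nhds.congr' ?_
    filter_upwards [eventually_ge_atTop u] with v hv
    -- Once the tail vanishes, the ratio is `0` by the convention on division by zero, so its limit
    -- is `0`. This contradicts the positive mass that `μ` gives to `{‖x‖ ≥ 2}`.
    rw [le_antisymm ((tail_antitone hv).trans h0.ge) (tail_nonneg v), div_zero]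
  have heq := tendsto_nhds_unique hlim (h.tendsto_radialBump hZ one_pos hab)
  have hle := le_integral_radialBump μ hab (h.isM0.2 1 one_pos)
  rw [← heq, h.measure_norm_ge two_pos] at hle
  have := h.measure_norm_ge_one_pos
  have : 0 < (2 : ℝ) ^ (-α) * μ.real {x : Vec m | 1 ≤ ‖x‖} := by positivity
  linarith

/-- The normalization by `P(|Z| > u)` fixes the mass. Cutoffs between `1` and `b > 1` bound `b^(-α)
c` by `1`, cutoffs between `a < 1` and `1` bound `a^(-α) c` below by `1`; then `a, b → 1`. -/
theorem IsRegularlyVarying.measure_norm_ge_one (h : IsRegularlyVarying P Z μ α)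
    (hZ : Measurable Z) : μ.real {x | 1 ≤ ‖x‖} = 1 := by
  set c := μ.real {x : Vec m | 1 ≤ ‖x‖} with hc
  have hcont : Tendsto (fun a : ℝ => a ^ (-α) * c) (𝓝 1) (𝓝 c) := by
    have : ContinuousAt (fun a : ℝ => a ^ (-α) * c) 1 :=
      (Real.continuousAt_rpow_const 1 (-α) (Or.inl one_ne_zero)).mul continuousAt_const
    simpa [ContinuousAt] using this
  apply le_antisymm
  · refine le_of_tendsto (hcont.mono_left (nhdsWithin_le_nhds (s := Set.Ioi 1))) ?_
    filter_upwards [self_mem_nhdsWithin] with b hb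
    have hb : 1 < b := hb
    rw [hc, ← h.measure_norm_ge (by linarith)]
    refine (le_integral_radialBump μ hb (h.isM0.2 1 one_pos)).trans
      (le_of_tendsto (h.tendsto_radialBump hZ one_pos hb) ?_)
    filter_upwards [eventually_gt_atTop 0] with u hu
    rw [div_le_one (h.tail_pos hZ u)]
    simpa using integral_radialBump_scaled_le (P := P) hZ hb hu
  · refine ge_of_tendsto (hcont.mono_left (nhdsWithin_le_nhds (s := Set.Iio 1))) ?_
    filter_upwards [self_mem_nhdsWithin,
      nhdsWithin_le_nhds (eventually_gt_nhds (one_pos : (0 : ℝ) < 1))] with a ha ha0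
    have ha : a < 1 := ha
    rw [hc, ← h.measure_norm_ge ha0]
    refine le_trans (ge_of_tendsto (h.tendsto_radialBump hZ ha0 ha) ?_)
      (integral_radialBump_le μ ha (h.isM0.2 a ha0))
    filter_upwards [eventually_gt_atTop 0] with u hu
    rw [one_le_div (h.tail_pos hZ u)]
    simpa using le_integral_radialBump_scaled (P := P) hZ ha hu

/-- The tail ratio at `2u` and `u` is asymptotically at most `μ{‖x‖ ≥ a} = a^(-α)` for any `a < 2`,
and `a` close to `2` loses less than the factor `2^η`. -/
theorem IsRegularlyVarying.eventually_tail_two_mul_le (h : IsRegularlyVarying P Z μ α)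
    (hZ : Measurable Z) {η : ℝ} (hη : 0 < η) :
    ∀ᶠ u in atTop, tail P Z (2 * u) ≤ 2 ^ (-(α - η)) * tail P Z u := by
  have hα := h.index_pos
  -- Chosen so that `a^(-α) = 2^(-α + η/2)`, strictly below the target `2^(-(α-η))`.
  set a : ℝ := 2 ^ (1 - η / (2 * α)) with ha
  have ha0 : 0 < a := by positivity
  have ha2 : a < 2 := by
    conv_rhs => rw [← Real.rpow_one 2]
    exact Real.rpow_lt_rpow_of_exponent_lt one_lt_two (by linarith [show 0 < η / (2 * α) by positivity])
  have hlt : ∫ x, radialBump a 2 x ∂μ < 2 ^ (-(α - η)) := by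
    refine (integral_radialBump_le μ ha2 (h.isM0.2 a ha0)).trans_lt ?_
    rw [h.measure_norm_ge ha0, h.measure_norm_ge_one hZ, mul_one, ha, ← Real.rpow_mul two_pos.le]
    refine Real.rpow_lt_rpow_of_exponent_lt one_lt_two ?_
    have : (1 - η / (2 * α)) * -α = -α + η / 2 := by field_simp; ring
    linarith
  filter_upwards [(h.tendsto_radialBump hZ ha0 ha2).eventually_lt_const hlt,
    eventually_gt_atTop 0] with u hu hu0
  rw [div_lt_iff₀ (h.tail_pos hZ u)] at hu
  exact (le_integral_radialBump_scaled hZ ha2 hu0).trans hu.le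

theorem IsRegularlyVarying.eventually_le_tail_two_mul (h : IsRegularlyVarying P Z μ α)
    (hZ : Measurable Z) {η : ℝ} (hη : 0 < η) :
    ∀ᶠ u in atTop, tail P Z u ≤ 2 ^ (α + η) * tail P Z (2 * u) := by
  have hα := h.index_pos
  set b : ℝ := 2 ^ (1 + η / (2 * α)) with hb
  have hb0 : 0 < b := by positivity
  have hb2 : 2 < b := by
    conv_lhs => rw [← Real.rpow_one 2]
    exact Real.rpow_lt_rpow_of_exponent_lt one_lt_two (by linarith [show 0 < η / (2 * α) by positivity])
  have hlt : 2 ^ (-(α + η)) < ∫ x, radialBump 2 b x ∂μ := by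
    refine lt_of_lt_of_le ?_ (le_integral_radialBump μ hb2 (h.isM0.2 2 two_pos))
    rw [h.measure_norm_ge hb0, h.measure_norm_ge_one hZ, mul_one, hb, ← Real.rpow_mul two_pos.le]
    refine Real.rpow_lt_rpow_of_exponent_lt one_lt_two ?_
    have : (1 + η / (2 * α)) * -α = -α - η / 2 := by field_simp; ring
    linarith
  filter_upwards [(h.tendsto_radialBump hZ two_pos hb2).eventually_const_lt hlt,
    eventually_gt_atTop 0] with u hu hu0
  rw [lt_div_iff₀ (h.tail_pos hZ u), Real.rpow_neg two_pos.le, inv_mul_lt_iff₀ (by positivity)] at hu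
  exact hu.le.trans (mul_le_mul_of_nonneg_left (integral_radialBump_scaled_le hZ hb2 hu0)
    (by positivity))

/-- Potter's bounds. -/
theorem IsRegularlyVarying.exists_tail_div_le (h : IsRegularlyVarying P Z μ α)
    (hZ : Measurable Z) {η : ℝ} (hη : 0 < η) (hηα : η < α) :
    ∃ C u₀ : ℝ, 0 < C ∧ 0 < u₀ ∧ ∀ u, u₀ ≤ u → ∀ a, 0 < a →
      tail P Z (u / a) ≤ C * (a ^ (α - η) + a ^ (α + η)) * tail P Z u := by
  obtain ⟨v₀, hv₀⟩ := eventually_atTop.1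
    ((h.eventually_tail_two_mul_le hZ hη).and (h.eventually_le_tail_two_mul hZ hη))
  set u₀ := max v₀ 1
  have hu₀ : 0 < u₀ := lt_of_lt_of_le one_pos (le_max_right _ _)
  have hstep : ∀ u, u₀ ≤ u → tail P Z (2 * u) ≤ 2 ^ (-(α - η)) * tail P Z u ∧
      tail P Z u ≤ 2 ^ (α + η) * tail P Z (2 * u) := fun u hu =>
    hv₀ u ((le_max_left _ _).trans hu)
  -- Iterating the doubling estimates costs nothing beyond the powers of `2^k`; passing from dyadic
  -- to general ratios then loses one extra factor of `2`, raised to `α ± η`.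
  have hiter : ∀ k : ℕ, ∀ u, u₀ ≤ u →
      tail P Z (2 ^ k * u) ≤ ((2 : ℝ) ^ k) ^ (-(α - η)) * tail P Z u ∧
      tail P Z u ≤ ((2 : ℝ) ^ k) ^ (α + η) * tail P Z (2 ^ k * u) := by
    intro k
    induction k with
    | zero => intro u _; simp
    | succ k ih =>
      intro u hu
      have hku : u₀ ≤ 2 ^ k * u := hu.trans
        (le_mul_of_one_le_left (hu₀.le.trans hu) (one_le_pow₀ one_le_two))
      have h1 := ih u hu
      have h2 := hstep _ hku
      have he : (2 : ℝ) ^ (k + 1) * u = 2 * (2 ^ k * u) := by ring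
      rw [he, pow_succ', Real.mul_rpow two_pos.le (by positivity),
        Real.mul_rpow two_pos.le (by positivity)]
      constructor
      · calc _ ≤ _ := h2.1
          _ ≤ 2 ^ (-(α - η)) * (((2 : ℝ) ^ k) ^ (-(α - η)) * tail P Z u) := by gcongr; exact h1.1
          _ = _ := by ring
      · calc _ ≤ _ := h1.2
          _ ≤ ((2 : ℝ) ^ k) ^ (α + η) * (2 ^ (α + η) * tail P Z (2 * (2 ^ k * u))) := by
            gcongr; exact h2.2
          _ = _ := by ring
  have hup : ∀ u, u₀ ≤ u → ∀ a, 0 < a → a ≤ 1 →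
      tail P Z (u / a) ≤ 2 ^ (α - η) * a ^ (α - η) * tail P Z u := by
    intro u hu a ha ha1
    obtain ⟨k, hk, hk'⟩ := exists_nat_pow_near (one_le_inv_iff₀.2 ⟨ha, ha1⟩) one_lt_two
    have hle : 2 ^ k * u ≤ u / a := by
      rw [div_eq_inv_mul]
      exact mul_le_mul_of_nonneg_right hk (hu₀.le.trans hu)
    refine (tail_antitone hle).trans ((hiter k u hu).1.trans ?_)
    refine mul_le_mul_of_nonneg_right ?_ (tail_nonneg u)
    rw [← Real.mul_rpow two_pos.le ha.le, Real.rpow_neg (by positivity),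
      ← Real.inv_rpow (by positivity)]
    refine Real.rpow_le_rpow (by positivity) ?_ (by linarith)
    rw [pow_succ, inv_lt_iff_one_lt_mul₀ ha] at hk'
    rw [inv_le_iff_one_le_mul₀ (by positivity)]
    nlinarith
  have hdown : ∀ u, ∀ a, 1 ≤ a → u₀ ≤ u / a →
      tail P Z (u / a) ≤ 2 ^ (α + η) * a ^ (α + η) * tail P Z u := by
    intro u a ha hua
    have ha0 : 0 < a := one_pos.trans_le ha
    obtain ⟨k, hk, hk'⟩ := exists_nat_pow_near ha one_lt_two
    refine (hiter (k + 1) _ hua).2.trans ?_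
    rw [← Real.mul_rpow two_pos.le ha0.le]
    refine mul_le_mul ?_ (tail_antitone ?_) (tail_nonneg _) (by positivity)
    · refine Real.rpow_le_rpow (by positivity) ?_ (by linarith)
      rw [pow_succ']
      linarith
    · have hu : 0 ≤ u / a := hu₀.le.trans hua
      calc u = a * (u / a) := by field_simp
        _ ≤ 2 ^ (k + 1) * (u / a) := by gcongr
  have hT := h.tail_pos hZ u₀
  -- The first entry serves `a ≤ 1`. The second serves `a ≥ 1`, and its denominator pays for the
  -- case where `u / a` drops below `u₀` and no doubling estimate is available.
  refine ⟨max (2 ^ (α - η)) (2 ^ (α + η) / tail P Z u₀), u₀,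
    lt_of_lt_of_le (by positivity) (le_max_left _ _), hu₀, fun u hu a ha => ?_⟩
  have hTu := tail_nonneg (P := P) (Z := Z) u
  have hT1 : 2 ^ (α + η) ≤ 2 ^ (α + η) / tail P Z u₀ := by
    rw [le_div_iff₀ hT]
    exact mul_le_of_le_one_right (by positivity) (tail_le_one u₀)
  rcases le_total a 1 with ha1 | ha1
  · refine (hup u hu a ha ha1).trans (mul_le_mul_of_nonneg_right ?_ hTu)
    refine mul_le_mul (le_max_left _ _) ?_ (by positivity)
      (le_trans (by positivity) (le_max_left _ _))
    exact le_add_of_nonneg_right (by positivity)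
  · have key : tail P Z (u / a) ≤ 2 ^ (α + η) / tail P Z u₀ * a ^ (α + η) * tail P Z u := by
      rcases le_total u₀ (u / a) with hua | hua
      · refine (hdown u a ha1 hua).trans ?_
        gcongr
      -- Here the tail at `u / a` is only bounded by `1`. Comparing `u₀` with `u` at the smaller
      -- ratio `u / u₀ ≤ a` bounds the tail at `u` from below.
      · refine (tail_le_one _).trans ?_
        have hu0 : u / (u / u₀) = u₀ := by
          have : u ≠ 0 := (hu₀.trans_le hu).ne'
          field_simp
        have := hdown u (u / u₀) ((one_le_div hu₀).2 hu) hu0.ge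
        rw [hu0] at this
        have hle : u / u₀ ≤ a := by
          rw [div_le_iff₀ hu₀]; rwa [div_le_iff₀ ha, mul_comm] at hua
        have hpow : (u / u₀) ^ (α + η) ≤ a ^ (α + η) :=
          Real.rpow_le_rpow (div_nonneg (hu₀.le.trans hu) hu₀.le) hle (by linarith)
        calc (1 : ℝ) = tail P Z u₀ / tail P Z u₀ := (div_self hT.ne').symm
          _ ≤ 2 ^ (α + η) * a ^ (α + η) * tail P Z u / tail P Z u₀ := by
            gcongr
            exact this.trans (by gcongr)
          _ = _ := by ring
    refine key.trans (mul_le_mul_of_nonneg_right ?_ hTu)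
    refine mul_le_mul (le_max_right _ _) ?_ (by positivity)
      (le_trans (by positivity) (le_max_left _ _))
    exact le_add_of_nonneg_left (by positivity)

end Tail

/-! ### Truncated and fractional moments of the noise -/

theorem lintegral_Ioc_ofReal_rpow {b r : ℝ} (hb : 0 ≤ b) (hr : -1 < r) :
    ∫⁻ t in Set.Ioc 0 b, ENNReal.ofReal (t ^ r) = ENNReal.ofReal (b ^ (r + 1) / (r + 1)) := by
  have hint : IntervalIntegrable (fun t : ℝ => t ^ r) volume 0 b :=
    intervalIntegral.intervalIntegrable_rpow' hr
  rw [← ofReal_integral_eq_lintegral_ofReal ((intervalIntegrable_iff_integrableOn_Ioc_of_le hb).1 hint)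
    ((ae_restrict_iff' measurableSet_Ioc).2 (ae_of_all _ fun t ht => Real.rpow_nonneg ht.1.le _)),
    ← intervalIntegral.integral_of_le hb, integral_rpow (Or.inl hr),
    Real.zero_rpow (by linarith), sub_zero]

section Moments

variable {Ω : Type*} [MeasurableSpace Ω] {P : Measure Ω} [IsProbabilityMeasure P] {m : ℕ}
  {Z : Ω → Vec m} {μ : Measure (Vec m)} {α : ℝ}

/-- A bound of Karamata type for the truncated first moment, uniform in the scale. -/
theorem IsRegularlyVarying.exists_lintegral_min_le (h : IsRegularlyVarying P Z μ α)
    (hZ : Measurable Z) {η : ℝ} (hη : 0 < η) (hηα : η < α) (hη1 : α + η < 1) :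
    ∃ C u₀ : ℝ, 0 < C ∧ 0 < u₀ ∧ ∀ u, u₀ ≤ u → ∀ ε, 0 < ε → ∀ a, 0 ≤ a →
      ∫⁻ ω, ENNReal.ofReal (min (a * ‖Z ω‖) (u * ε)) ∂P ≤
        ENNReal.ofReal (C * (u * tail P Z u) *
          (a ^ (α - η) * ε ^ (1 - (α - η)) + a ^ (α + η) * ε ^ (1 - (α + η)))) := by
  obtain ⟨C, u₀, hC, hu₀, hpot⟩ := h.exists_tail_div_le hZ hη hηα
  -- Integrating `t^(-s)` for `s = α ± η` yields denominators `1 - s`; the smaller one, `1 - (α +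
  -- η)`, serves for both.
  refine ⟨C / (1 - (α + η)), u₀, div_pos hC (by linarith), hu₀, fun u hu ε hε a ha => ?_⟩
  have hu0 : 0 < u := hu₀.trans_le hu
  have hb : 0 < u * ε := mul_pos hu0 hε
  have hT := tail_nonneg (P := P) (Z := Z) u
  rcases ha.eq_or_lt with rfl | ha
  · simp [min_eq_left hb.le]
  rw [lintegral_eq_lintegral_meas_lt P (ae_of_all _ fun ω => le_min (by positivity) hb.le)
    ((hZ.norm.const_mul a).min measurable_const).aemeasurable]
  -- Levels above `uε` contribute nothing, and below them Potter's bounds apply with ratio `au/t`,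
  -- which may be large or small.
  have hpt : ∀ t ∈ Set.Ioi (0 : ℝ), P {ω | t < min (a * ‖Z ω‖) (u * ε)} ≤
      (Set.Ioc 0 (u * ε)).indicator (fun t =>
        ENNReal.ofReal (C * tail P Z u * (a * u) ^ (α - η)) * ENNReal.ofReal (t ^ (-(α - η))) +
        ENNReal.ofReal (C * tail P Z u * (a * u) ^ (α + η)) * ENNReal.ofReal (t ^ (-(α + η)))) t := by
    intro t ht
    have ht : 0 < t := ht
    by_cases htb : t ≤ u * ε
    · rw [Set.indicator_of_mem (Set.mem_Ioc.2 ⟨ht, htb⟩), ← ENNReal.ofReal_mul (by positivity),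
        ← ENNReal.ofReal_mul (by positivity), ← ENNReal.ofReal_add (by positivity) (by positivity)]
      calc P {ω | t < min (a * ‖Z ω‖) (u * ε)}
          ≤ P {ω | u / (a * u / t) < ‖Z ω‖} := by
            refine measure_mono (Set.ofPred_subset_ofPred.2 fun ω hω => ?_)
            have := hω.trans_le (min_le_left _ _)
            have he : u / (a * u / t) = t / a := by field_simp
            rwa [he, div_lt_iff₀' ha]
        _ = ENNReal.ofReal (tail P Z (u / (a * u / t))) := (ofReal_tail _).symm
        _ ≤ _ := by
            refine ENNReal.ofReal_le_ofReal ((hpot u hu _ (by positivity)).trans_eq ?_)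
            rw [Real.div_rpow (by positivity) ht.le, Real.div_rpow (by positivity) ht.le,
              Real.rpow_neg ht.le, Real.rpow_neg ht.le]
            ring
    · rw [Set.indicator_of_notMem (fun hmem => htb hmem.2), nonpos_iff_eq_zero]
      refine measure_mono_null (t := ∅) (fun ω hω => ?_) measure_empty
      have hω : t < min (a * ‖Z ω‖) (u * ε) := hω
      exact htb (hω.trans_le (min_le_right _ _)).le
  have hval : ∀ s, 0 ≤ s → s < 1 → C * tail P Z u * (a * u) ^ s * ((u * ε) ^ (-s + 1) / (-s + 1)) =
      C * tail P Z u * (u * (a ^ s * ε ^ (1 - s)) / (1 - s)) := by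
    intro s hs hs1
    have hu' : u ^ s * u ^ (1 - s) = u := by
      rw [← Real.rpow_add hu0]; simp
    rw [Real.mul_rpow ha.le hu0.le, Real.mul_rpow hu0.le hε.le, neg_add_eq_sub]
    calc _ = C * tail P Z u * ((u ^ s * u ^ (1 - s)) * (a ^ s * ε ^ (1 - s)) / (1 - s)) := by ring
      _ = _ := by rw [hu']
  refine (setLIntegral_mono' measurableSet_Ioi hpt).trans ?_
  refine (setLIntegral_le_lintegral _ _).trans ?_
  rw [lintegral_indicator measurableSet_Ioc, lintegral_add_left (by fun_prop),
    lintegral_const_mul _ (by fun_prop), lintegral_const_mul _ (by fun_prop),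
    lintegral_Ioc_ofReal_rpow hb.le (by linarith), lintegral_Ioc_ofReal_rpow hb.le (by linarith),
    ← ENNReal.ofReal_mul (by positivity), ← ENNReal.ofReal_mul (by positivity),
    hval _ (by linarith) (by linarith), hval _ (by linarith) (by linarith),
    ← ENNReal.ofReal_add]
  · refine ENNReal.ofReal_le_ofReal ?_
    have h1 : u * (a ^ (α - η) * ε ^ (1 - (α - η))) / (1 - (α - η)) ≤
        u * (a ^ (α - η) * ε ^ (1 - (α - η))) / (1 - (α + η)) :=
      div_le_div_of_nonneg_left (by positivity) (by linarith) (by linarith)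
    calc _ ≤ C * tail P Z u * (u * (a ^ (α - η) * ε ^ (1 - (α - η))) / (1 - (α + η))) +
          C * tail P Z u * (u * (a ^ (α + η) * ε ^ (1 - (α + η))) / (1 - (α + η))) := by gcongr
      _ = _ := by ring
  · exact mul_nonneg (by positivity) (div_nonneg (by positivity) (by linarith))
  · exact mul_nonneg (by positivity) (div_nonneg (by positivity) (by linarith))

/-- Potter's bounds at the fixed base `u₀` with ratio `u₀/t < 1` make the tail `O(t^(-(α+β)/2))`.
Since `(α+β)/2 > β`, the layer-cake integral of `tail(t) t^(β-1)` converges at infinity. -/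
theorem IsRegularlyVarying.lintegral_enorm_rpow_lt_top (h : IsRegularlyVarying P Z μ α)
    (hZ : Measurable Z) {β : ℝ} (hβ : 0 < β) (hβα : β < α) :
    ∫⁻ ω, ‖Z ω‖ₑ ^ β ∂P < ⊤ := by
  obtain ⟨C, u₀, hC, hu₀, hpot⟩ := h.exists_tail_div_le hZ (η := (α - β) / 2)
    (by linarith) (by linarith)
  have hT := tail_nonneg (P := P) (Z := Z) u₀
  have hnorm : ∀ ω, ‖Z ω‖ₑ ^ β = ENNReal.ofReal (‖Z ω‖ ^ β) := fun ω => by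
    rw [← ofReal_norm, ENNReal.ofReal_rpow_of_nonneg (norm_nonneg _) hβ.le]
  simp_rw [hnorm]
  rw [lintegral_rpow_eq_lintegral_meas_lt_mul P (ae_of_all _ fun ω => norm_nonneg _)
    hZ.norm.aemeasurable hβ]
  refine ENNReal.mul_lt_top ENNReal.ofReal_lt_top ?_
  rw [← Set.Ioc_union_Ioi_eq_Ioi hu₀.le,
    lintegral_union measurableSet_Ioi (Set.Ioc_disjoint_Ioi le_rfl)]
  refine ENNReal.add_lt_top.2 ⟨?_, ?_⟩
  · calc _ ≤ ∫⁻ t in Set.Ioc 0 u₀, ENNReal.ofReal (t ^ (β - 1)) :=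
          lintegral_mono fun t => mul_le_of_le_one_left' prob_le_one
      _ < ⊤ := by
          rw [lintegral_Ioc_ofReal_rpow hu₀.le (by linarith)]
          exact ENNReal.ofReal_lt_top
  · have hint : IntegrableOn (fun t : ℝ => (2 * C * tail P Z u₀ * u₀ ^ ((α + β) / 2)) *
        t ^ (-((α - β) / 2) - 1)) (Set.Ioi u₀) :=
      (integrableOn_Ioi_rpow_of_lt (by linarith) hu₀).const_mul _
    refine lt_of_le_of_lt (setLIntegral_mono' measurableSet_Ioi fun t ht => ?_)
      hint.lintegral_lt_top
    have ht : u₀ < t := ht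
    have ht0 : 0 < t := hu₀.trans ht
    rw [← ofReal_tail, ← ENNReal.ofReal_mul (tail_nonneg _)]
    refine ENNReal.ofReal_le_ofReal ?_
    have hp := hpot u₀ le_rfl (u₀ / t) (by positivity)
    rw [div_div_cancel₀ hu₀.ne'] at hp
    have hpow : (u₀ / t) ^ (α + (α - β) / 2) ≤ (u₀ / t) ^ (α - (α - β) / 2) :=
      Real.rpow_le_rpow_of_exponent_ge (by positivity) ((div_le_one ht0).2 ht.le) (by linarith)
    have hexp : α - (α - β) / 2 = (α + β) / 2 := by ring
    calc tail P Z t * t ^ (β - 1)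
        ≤ C * ((u₀ / t) ^ ((α + β) / 2) + (u₀ / t) ^ ((α + β) / 2)) * tail P Z u₀ *
            t ^ (β - 1) := by
          rw [hexp] at hp hpow
          gcongr
          exact hp.trans (by gcongr)
      _ = (2 * C * tail P Z u₀ * u₀ ^ ((α + β) / 2)) * (t ^ (-((α + β) / 2)) * t ^ (β - 1)) := by
          rw [Real.div_rpow hu₀.le ht0.le, Real.rpow_neg ht0.le]
          ring
      _ = _ := by
          rw [← Real.rpow_add ht0]
          congr 2
          ring

end Moments

/-! ### Subadditivity of powers and truncations -/

theorem ennreal_rpow_le_add_rpow {s r t : ℝ} (hsr : s ≤ r) (hrt : r ≤ t) (x : ℝ≥0∞) :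
    x ^ r ≤ x ^ s + x ^ t := by
  rcases le_total x 1 with hx | hx
  · exact (ENNReal.rpow_le_rpow_of_exponent_ge hx hsr).trans le_self_add
  · exact (ENNReal.rpow_le_rpow_of_exponent_le hx hrt).trans le_add_self

theorem ennreal_rpow_finset_sum_le {ι : Type*} (s : Finset ι) (f : ι → ℝ≥0∞) {p : ℝ} (hp : 0 < p)
    (hp1 : p ≤ 1) : (∑ i ∈ s, f i) ^ p ≤ ∑ i ∈ s, f i ^ p := by
  classical
  induction s using Finset.induction_on with
  | empty => simp [hp]
  | insert i s hi ih =>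
    rw [Finset.sum_insert hi, Finset.sum_insert hi]
    exact (ENNReal.rpow_add_le_add_rpow _ _ hp.le hp1).trans (by gcongr)

theorem ennreal_rpow_tsum_le {ι : Type*} (f : ι → ℝ≥0∞) {p : ℝ} (hp : 0 < p) (hp1 : p ≤ 1) :
    (∑' i, f i) ^ p ≤ ∑' i, f i ^ p := by
  rw [← ENNReal.le_rpow_inv_iff hp, ENNReal.tsum_eq_iSup_sum]
  refine iSup_le fun s => ?_
  rw [ENNReal.le_rpow_inv_iff hp]
  exact (ennreal_rpow_finset_sum_le s f hp hp1).trans (ENNReal.sum_le_tsum s)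

/-- Either some term already reaches the level `b`, and alone gives the bound, or truncation changes
no term on the right. -/
theorem ennreal_min_tsum_le {ι : Type*} (f : ι → ℝ≥0∞) (b : ℝ≥0∞) :
    min (∑' i, f i) b ≤ ∑' i, min (f i) b := by
  by_cases h : ∃ i, b ≤ f i
  · obtain ⟨i, hi⟩ := h
    calc min (∑' i, f i) b ≤ b := min_le_right _ _
      _ = min (f i) b := (min_eq_right hi).symm
      _ ≤ ∑' i, min (f i) b := ENNReal.le_tsum i
  · push Not at h
    refine (min_le_left _ _).trans (le_of_eq (tsum_congr fun i => ?_))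
    exact (min_eq_left (h i).le).symm

instance matBorelSpace (d p : ℕ) : BorelSpace (Mat d p) :=
  inferInstanceAs (BorelSpace (Fin d → Fin p → ℝ))

instance matSecondCountableTopology (d p : ℕ) : SecondCountableTopology (Mat d p) :=
  inferInstanceAs (SecondCountableTopology (Fin d → Fin p → ℝ))

/-! ### Suprema over subset sums -/

section SubsetSums

/-- Each subset sum is a limit of finite ones, and the norm is continuous. This replaces an
uncountable supremum by a countable one, which yields measurability. -/
theorem iSup_enorm_tsum_subtype_rpow {ι E : Type*} [NormedAddCommGroup E] [CompleteSpace E]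
    {f : ι → E} (hf : Summable f) (α : ℝ) :
    ⨆ J : Set ι, ‖∑' j : J, f j‖ₑ ^ α = ⨆ s : Finset ι, ‖∑ j ∈ s, f j‖ₑ ^ α := by
  apply le_antisymm
  · refine iSup_le fun J => ?_
    have hcont : Continuous fun x : E => ‖x‖ₑ ^ α := ENNReal.continuous_rpow_const.comp continuous_enorm
    refine le_of_tendsto ((hcont.tendsto _).comp (hf.subtype J).hasSum)
      (Eventually.of_forall fun t => ?_)
    have := le_iSup (fun s : Finset ι => ‖∑ j ∈ s, f j‖ₑ ^ α)
      (t.map (Function.Embedding.subtype (· ∈ J)))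
    rwa [Finset.sum_map] at this
  · refine iSup_le fun s => ?_
    rw [← Finset.tsum_subtype' s f]
    exact le_iSup (fun J : Set ι => ‖∑' j : J, f j‖ₑ ^ α) s

theorem iSup_enorm_tsum_subtype_rpow_le {ι E : Type*} [NormedAddCommGroup E] (f : ι → E) {α : ℝ}
    (hα : 0 ≤ α) : ⨆ J : Set ι, ‖∑' j : J, f j‖ₑ ^ α ≤ (∑' j, ‖f j‖ₑ) ^ α := by
  refine iSup_le fun J => ENNReal.rpow_le_rpow (enorm_tsum_le_tsum_enorm.trans ?_) hα
  exact ENNReal.tsum_comp_le_tsum_of_injective Subtype.val_injective fun j => ‖f j‖ₑ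

end SubsetSums

/-! ### Summability of the coefficients, and divergence of the normalizing sequence -/

section Normalization

variable {Ω : Type*} [MeasurableSpace Ω] {P : Measure Ω}

theorem summA_of_absSummA {d p : ℕ} {A : ℤ → ℤ → Ω → Mat d p} {α : ℝ} (hα : 0 < α)
    (hA : ∀ j, Measurable (A j j)) (h : AbsSummA P A α) : SummA P A α := by
  have hsum : ∀ᵐ ω ∂P, Summable fun j : ℤ => A j j ω := by
    have hmeas : AEMeasurable (fun ω => (∑' j : ℤ, ‖A j j ω‖ₑ) ^ α) P :=
      ((Measurable.tsum fun j => (hA j).enorm).pow_const α).aemeasurable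
    filter_upwards [ae_lt_top' hmeas h.ne] with ω hω
    refine Summable.of_norm (tsum_enorm_ne_top_iff_summable_norm.1 fun htop => ?_)
    rw [htop, ENNReal.top_rpow_of_pos hα] at hω
    exact lt_irrefl _ hω
  refine ⟨hsum, ?_, ?_⟩
  · have hmeas : Measurable fun ω => ⨆ s : Finset ℤ, ‖∑ j ∈ s, A j j ω‖ₑ ^ α :=
      Measurable.iSup fun s => (Finset.measurable_fun_sum s fun j _ => hA j).enorm.pow_const α
    refine hmeas.aemeasurable.congr ?_
    filter_upwards [hsum] with ω hω
    exact (iSup_enorm_tsum_subtype_rpow hω α).symm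
  · exact (lintegral_mono fun ω =>
      iSup_enorm_tsum_subtype_rpow_le (fun j => A j j ω) hα.le).trans_lt h

variable [IsProbabilityMeasure P]

/-- By Fubini the left side is an average over the values of `U`, and some value is at least the
average. -/
theorem exists_le_measure_of_indep {m : ℕ} {U V : Ω → Vec m} (hU : Measurable U) (hV : Measurable V)
    (h : IndepFun U V P) {s : Set (Vec m)} (hs : MeasurableSet s) :
    ∃ x, P {ω | U ω + V ω ∈ s} ≤ P {ω | x + V ω ∈ s} := by
  have hpre : MeasurableSet ((fun q : Vec m × Vec m => q.1 + q.2) ⁻¹' s) :=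
    measurable_add hs
  have : P {ω | U ω + V ω ∈ s} = ∫⁻ ω, P {ω' | U ω + V ω' ∈ s} ∂P := by
    have h1 : P {ω | U ω + V ω ∈ s} = P.map (fun ω => (U ω, V ω))
        ((fun q : Vec m × Vec m => q.1 + q.2) ⁻¹' s) := by
      rw [Measure.map_apply (hU.prodMk hV) hpre]; rfl
    rw [h1, h.map_prod_eq_prod_map_map hU.aemeasurable hV.aemeasurable, Measure.prod_apply hpre,
      lintegral_map (measurable_measure_prodMk_left hpre) hU]
    refine lintegral_congr fun ω => ?_
    rw [Measure.map_apply hV (measurable_prodMk_left hpre)]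
    rfl
  obtain ⟨ω, hω⟩ := exists_lintegral_le (μ := P) (f := fun ω => P {ω' | U ω + V ω' ∈ s})
    (this ▸ measure_ne_top _ _)
  exact ⟨U ω, this ▸ hω⟩

/-- If a variable is unbounded, then no translate of it is concentrated near the origin. -/
theorem exists_pos_measure_add_norm_ge {m : ℕ} {V : Ω → Vec m}
    (hunb : ∀ u : ℝ, 0 < tail P V u) (M : ℝ) :
    ∃ θ : ℝ≥0∞, 0 < θ ∧ ∀ x : Vec m, θ ≤ P {ω | x + V ω ∈ (Metric.ball (0 : Vec m) M)ᶜ} := by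
  have hpos : ∀ u : ℝ, 0 < P {ω | u < ‖V ω‖} := fun u => by
    rw [← ofReal_tail]; exact ENNReal.ofReal_pos.2 (hunb u)
  obtain ⟨R, hR⟩ : ∃ R : ℝ, 0 < P {ω | ‖V ω‖ ≤ R} := by
    by_contra! hcon
    have hz : P (⋃ n : ℕ, {ω | ‖V ω‖ ≤ n}) = 0 :=
      measure_iUnion_null fun n => nonpos_iff_eq_zero.1 (hcon n)
    have hu : (⋃ n : ℕ, {ω | ‖V ω‖ ≤ n}) = Set.univ := by
      refine Set.eq_univ_of_forall fun ω => ?_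
      obtain ⟨n, hn⟩ := exists_nat_ge ‖V ω‖
      exact Set.mem_iUnion.2 ⟨n, hn⟩
    rw [hu, measure_univ] at hz
    exact one_ne_zero hz
  -- A translation by `‖x‖ ≥ R + M` moves the bulk `‖V‖ ≤ R` outside the ball of radius `M`; one by
  -- `‖x‖ ≤ R + M` cannot bring back the values with `‖V‖ > R + 2M`.
  refine ⟨min (P {ω | ‖V ω‖ ≤ R}) (P {ω | R + 2 * M < ‖V ω‖}), lt_min hR (hpos _), fun x => ?_⟩
  rcases le_total (R + M) ‖x‖ with hx | hx
  · refine (min_le_left _ _).trans (measure_mono (Set.ofPred_subset_ofPred.2 fun ω hω => ?_))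
    rw [Set.mem_compl_iff, mem_ball_zero_iff, not_lt]
    have := norm_sub_le (x + V ω) (V ω)
    rw [add_sub_cancel_right] at this
    linarith
  · refine (min_le_right _ _).trans (measure_mono (Set.ofPred_subset_ofPred.2 fun ω hω => ?_))
    rw [Set.mem_compl_iff, mem_ball_zero_iff, not_lt]
    have := norm_sub_le (x + V ω) x
    rw [add_sub_cancel_left] at this
    linarith

/-- If `γ_n < M`, the partial sum leaves the ball of radius `M` with probability at least `θ`, since
adding an independent variable to `Z_1` cannot concentrate it more than the best translation does.
For large `n` this contradicts convergence to `0` in probability. -/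
theorem IsNormalizing.tendsto_atTop {m : ℕ} {Z : ℤ → Ω → Vec m} {α : ℝ} {γ : ℕ → ℝ}
    (h : IsNormalizing P Z α γ) (hZ : ∀ k, Measurable (Z k)) (hind : iIndepFun Z P)
    (hid : ∀ k, IdentDistrib (Z k) (Z 0) P P) (hunb : ∀ u : ℝ, 0 < tail P (Z 0) u) :
    Tendsto γ atTop atTop := by
  refine Filter.tendsto_atTop.2 fun M => ?_
  obtain ⟨θ, hθ, hθx⟩ := exists_pos_measure_add_norm_ge hunb M
  have hlim := h.sum_tendsto 1 one_pos
  filter_upwards [hlim.eventually_lt_const hθ, eventually_ge_atTop 1] with n hn hn1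
  by_contra! hγ
  have hγ0 := h.pos n hn1
  refine absurd hn (not_lt.2 ?_)
  set U : Ω → Vec m := ∑ k ∈ Finset.Icc (2 : ℤ) n, Z k
  have hU_eq : U = fun ω => ∑ k ∈ Finset.Icc (2 : ℤ) n, Z k ω := funext fun ω => Finset.sum_apply ω _ _
  have hU : Measurable U := hU_eq ▸ Finset.measurable_fun_sum _ fun k _ => hZ k
  have hUV : IndepFun U (Z 1) P :=
    hind.indepFun_finsetSum_of_notMem hZ (by simp)
  have hs : MeasurableSet (Metric.ball (0 : Vec m) M) := Metric.isOpen_ball.measurableSet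
  obtain ⟨x, hx⟩ := exists_le_measure_of_indep hU (hZ 1) hUV hs
  have hmeas : ∀ V : Ω → Vec m, Measurable V → P {ω | V ω ∈ (Metric.ball (0 : Vec m) M)ᶜ} =
      1 - P {ω | V ω ∈ Metric.ball (0 : Vec m) M} := fun V hV =>
    prob_compl_eq_one_sub (hV hs)
  calc θ ≤ P {ω | x + Z 0 ω ∈ (Metric.ball (0 : Vec m) M)ᶜ} := hθx x
    _ = P {ω | x + Z 1 ω ∈ (Metric.ball (0 : Vec m) M)ᶜ} :=
        (((hid 1).comp (measurable_const_add x)).measure_mem_eq hs.compl).symm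
    _ = 1 - P {ω | x + Z 1 ω ∈ Metric.ball (0 : Vec m) M} := hmeas _ ((hZ 1).const_add x)
    _ ≤ 1 - P {ω | U ω + Z 1 ω ∈ Metric.ball (0 : Vec m) M} := tsub_le_tsub_left hx 1
    _ = P {ω | U ω + Z 1 ω ∈ (Metric.ball (0 : Vec m) M)ᶜ} := (hmeas _ (hU.add (hZ 1))).symm
    _ ≤ _ := by
      refine measure_mono (Set.ofPred_subset_ofPred.2 fun ω hω => ?_)
      have hsum : ∑ k ∈ Finset.Icc 1 n, Z (k : ℤ) ω = U ω + Z 1 ω := by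
        have h1 : ∑ k ∈ Finset.Icc 1 n, Z (k : ℤ) ω = ∑ k ∈ Finset.Icc (1 : ℤ) n, Z k ω := by
          refine Finset.sum_bij (fun k _ => (k : ℤ)) ?_ ?_ ?_ (fun _ _ => rfl)
          · intro k hk
            rw [Finset.mem_Icc] at hk ⊢
            omega
          · intro a _ b _ hab
            exact_mod_cast hab
          · intro b hb
            rw [Finset.mem_Icc] at hb
            exact ⟨b.toNat, Finset.mem_Icc.2 (by omega), by omega⟩
        have h2 : Finset.Icc (1 : ℤ) n = insert 1 (Finset.Icc (2 : ℤ) n) := by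
          ext k
          simp only [Finset.mem_Icc, Finset.mem_insert]
          omega
        rw [h1, h2, Finset.sum_insert (by simp), add_comm, hU_eq]
      rw [Set.mem_compl_iff, mem_ball_zero_iff, not_lt] at hω
      rw [hsum, edist_zero_right, ← ofReal_norm, ← ENNReal.ofReal_one]
      refine ENNReal.ofReal_le_ofReal ?_
      rw [norm_smul, norm_inv, Real.norm_of_nonneg hγ0.le, inv_mul_eq_div, one_le_div hγ0]
      exact hγ.le.trans hω

end Normalization

/-! ### Pathwise domination of the truncated process -/

section Pathwise

variable {Ω : Type*} {d p : ℕ}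

theorem enorm_term_le (A : ℤ → ℤ → Ω → Mat d p) (Z : ℤ → Ω → Vec p) (k j : ℤ) (ω : Ω) :
    ‖term A Z k j ω‖ₑ ≤ ‖A k j ω‖ₑ * ‖Z (k - j) ω‖ₑ := by
  rw [← ofReal_norm, ← ofReal_norm, ← ofReal_norm, ← ENNReal.ofReal_mul (norm_nonneg _)]
  exact ENNReal.ofReal_le_ofReal (Matrix.l2_opNorm_mulVec (A k j ω) (Z (k - j) ω))

theorem enorm_truncate_le {b : ℝ} (x : Vec d) :
    ‖truncate b x‖ₑ ≤ min ‖x‖ₑ (ENNReal.ofReal b) := by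
  by_cases hx : ‖x‖ ≤ b
  · rw [truncate, Set.indicator_of_mem (by exact hx), id]
    refine le_min le_rfl ?_
    rw [← ofReal_norm]
    exact ENNReal.ofReal_le_ofReal hx
  · rw [truncate, Set.indicator_of_notMem (by exact hx)]
    simp

/-- Truncation moves inside the series by subadditivity. No summability is needed, since a divergent
`tsum` is `0` by convention. -/
theorem enorm_truncate_X_le (A : ℤ → ℤ → Ω → Mat d p) (Z : ℤ → Ω → Vec p) (b : ℝ) (k : ℤ) (ω : Ω) :
    ‖truncate b (X A Z k ω)‖ₑ ≤
      ∑' j, min (‖A k j ω‖ₑ * ‖Z (k - j) ω‖ₑ) (ENNReal.ofReal b) :=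
  (enorm_truncate_le _).trans ((min_le_min_right _ (enorm_tsum_le_tsum_enorm.trans
    (ENNReal.tsum_le_tsum fun j => enorm_term_le A Z k j ω))).trans (ennreal_min_tsum_le _ _))

end Pathwise

section SmallJumps

variable {Ω : Type*} [MeasurableSpace Ω] {P : Measure Ω} {d p : ℕ}

/-! ### Consequences of the moment conditions for `α ≤ 1` -/

section MomentCondition

variable {A : ℤ → Ω → Mat d p} {α : ℝ}

theorem lintegral_tsum_enorm_rpow (hA : ∀ j, Measurable (A j)) (s : ℝ) :
    ∫⁻ ω, ∑' j, ‖A j ω‖ₑ ^ s ∂P = ∑' j, ∫⁻ ω, ‖A j ω‖ₑ ^ s ∂P :=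
  lintegral_tsum fun j => ((hA j).enorm.pow_const s).aemeasurable

theorem MomentCondition.exists_forall_tsum_lt_top (h : MomentCondition P A α)
    (hA : ∀ j, Measurable (A j)) (hα : 0 < α) (hα1 : α < 1) :
    ∃ ε, 0 < ε ∧ ε < α ∧ ∀ s, α - ε ≤ s → s ≤ α + ε → ∑' j, ∫⁻ ω, ‖A j ω‖ₑ ^ s ∂P < ⊤ := by
  obtain ⟨ε, hε, hεα, h1, -, -⟩ := h
  obtain ⟨hlow, hhigh⟩ := h1 (Or.inl ⟨hα, hα1⟩)
  refine ⟨ε, hε, hεα, fun s hs hs' => lt_of_le_of_lt ?_ (ENNReal.add_lt_top.2 ⟨hlow, hhigh⟩)⟩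
  rw [← ENNReal.tsum_add]
  refine ENNReal.tsum_le_tsum fun j => ?_
  rw [← lintegral_add_left ((hA j).enorm.pow_const _)]
  exact lintegral_mono fun ω => ennreal_rpow_le_add_rpow hs hs' _

/-- If `(∑ ‖A_j‖^β)^q` is integrable, then so is `(∑ ‖A_j‖^β)^r` for `0 ≤ r ≤ q`. -/
theorem lintegral_tsum_rpow_lt_top [IsProbabilityMeasure P] {β q r : ℝ} (hr : 0 ≤ r) (hrq : r ≤ q)
    (h : ∫⁻ ω, (∑' j, ‖A j ω‖ₑ ^ β) ^ q ∂P < ⊤) :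
    ∫⁻ ω, (∑' j, ‖A j ω‖ₑ ^ β) ^ r ∂P < ⊤ := by
  calc ∫⁻ ω, (∑' j, ‖A j ω‖ₑ ^ β) ^ r ∂P
      ≤ ∫⁻ ω, (1 + (∑' j, ‖A j ω‖ₑ ^ β) ^ q) ∂P := lintegral_mono fun ω => by
        simpa using ennreal_rpow_le_add_rpow hr hrq (∑' j, ‖A j ω‖ₑ ^ β)
    _ = 1 + ∫⁻ ω, (∑' j, ‖A j ω‖ₑ ^ β) ^ q ∂P := by
        rw [lintegral_add_left measurable_const]; simp
    _ < ⊤ := ENNReal.add_lt_top.2 ⟨ENNReal.one_lt_top, h⟩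

theorem MomentCondition.exists_tsum_lt_top [IsProbabilityMeasure P] (h : MomentCondition P A α)
    (hA : ∀ j, Measurable (A j)) (hα : 0 < α) (hα1 : α ≤ 1) :
    ∃ β, 0 < β ∧ β < α ∧ ∑' j, ∫⁻ ω, ‖A j ω‖ₑ ^ β ∂P < ⊤ := by
  rcases hα1.lt_or_eq with hα1 | rfl
  · obtain ⟨ε, hε, hεα, hs⟩ := h.exists_forall_tsum_lt_top hA hα hα1
    exact ⟨α - ε, by linarith, by linarith, hs _ le_rfl (by linarith)⟩
  · obtain ⟨ε, hε, hε1, -, h1, -⟩ := h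
    refine ⟨1 - ε, by linarith, by linarith, ?_⟩
    rw [← lintegral_tsum_enorm_rpow hA]
    have hq : 1 ≤ (1 + ε) / (1 - ε) := by rw [one_le_div (by linarith)]; linarith
    simpa using lintegral_tsum_rpow_lt_top zero_le_one hq (h1 (Or.inl rfl))

/-- For `α = 1`, subadditivity gives `∑ ‖A_j‖ ≤ (∑ ‖A_j‖^(1-ε))^(1/(1-ε))`, and the outer exponent
does not exceed the assumed `(1+ε)/(1-ε)`. -/
theorem MomentCondition.tsum_rpow_index_lt_top [IsProbabilityMeasure P]
    (h : MomentCondition P A α) (hA : ∀ j, Measurable (A j)) (hα : 0 < α) (hα1 : α ≤ 1) :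
    ∑' j, ∫⁻ ω, ‖A j ω‖ₑ ^ α ∂P < ⊤ := by
  rcases hα1.lt_or_eq with hα1 | rfl
  · obtain ⟨ε, hε, hεα, hs⟩ := h.exists_forall_tsum_lt_top hA hα hα1
    exact hs α (by linarith) (by linarith)
  · obtain ⟨ε, hε, hε1, -, h1, -⟩ := h
    have hβ : 0 < 1 - ε := by linarith
    rw [← lintegral_tsum_enorm_rpow hA]
    have hq : (1 - ε)⁻¹ ≤ (1 + ε) / (1 - ε) := by
      rw [inv_eq_one_div]; gcongr; linarith
    refine lt_of_le_of_lt (lintegral_mono fun ω => ?_)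
      (lintegral_tsum_rpow_lt_top (inv_nonneg.2 hβ.le) hq (h1 (Or.inl rfl)))
    simp only [ENNReal.rpow_one]
    rw [ENNReal.le_rpow_inv_iff hβ]
    exact ennreal_rpow_tsum_le _ hβ (by linarith)

end MomentCondition

/-! ### Moment bounds for the process and the conclusions -/

section Hypotheses

variable {A : ℤ → ℤ → Ω → Mat d p} {Z : ℤ → Ω → Vec p}
  {μ : Measure (Vec p)} {α : ℝ} {γ : ℕ → ℝ}

theorem Hypotheses.identDistrib_A (h : Hypotheses P A Z μ α γ) (k j : ℤ) :
    IdentDistrib (A k j) (A 0 j) P P := by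
  have hm : Measurable fun x : ℤ → ℤ → Mat d p => x 0 j :=
    (measurable_pi_apply j).comp (measurable_pi_apply 0)
  simpa [Function.comp_def] using (h.stationary_A k).comp hm

theorem smallJump_of_absSmallJump (h : AbsSmallJump P A Z γ) : SmallJump P A Z γ := by
  intro δ hδ
  refine tendsto_of_tendsto_of_tendsto_of_le_of_le tendsto_const_nhds (h δ hδ)
    (fun _ => zero_le) fun ε => ?_
  refine limsup_le_limsup (Eventually.of_forall fun n => ?_) (by isBoundedDefault)
    (by isBoundedDefault)
  refine mul_le_mul_right (measure_mono (Set.ofPred_subset_ofPred.2 fun ω hω => ?_)) _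
  exact hω.trans_le (norm_sum_le _ _)

variable [IsProbabilityMeasure P]

/-- A coefficient and a noise variable may be replaced by the generic independent pair. -/
theorem Hypotheses.lintegral_comp_enorm (h : Hypotheses P A Z μ α γ) {F : ℝ≥0∞ × ℝ≥0∞ → ℝ≥0∞}
    (hF : Measurable F) (k j i : ℤ) :
    ∫⁻ ω, F (‖A k j ω‖ₑ, ‖Z i ω‖ₑ) ∂P = ∫⁻ ω, ∫⁻ ω', F (‖A 0 j ω‖ₑ, ‖Z 0 ω'‖ₑ) ∂P ∂P := by
  have hA : ∀ k, Measurable fun ω => ‖A k j ω‖ₑ := fun k =>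
    (h.measurable_A k j).enorm
  have hZ : ∀ i, Measurable fun ω => ‖Z i ω‖ₑ := fun i => (h.measurable_Z i).enorm
  have hind : IndepFun (fun ω => ‖A k j ω‖ₑ) (fun ω => ‖Z i ω‖ₑ) P :=
    h.indep_A_Z.comp (φ := fun x : ℤ → ℤ → Mat d p => ‖x k j‖ₑ) (ψ := fun z : ℤ → Vec p => ‖z i‖ₑ)
      (((measurable_pi_apply j).comp (measurable_pi_apply k)).enorm)
      (measurable_pi_apply i).enorm
  have hAeq : P.map (fun ω => ‖A k j ω‖ₑ) = P.map (fun ω => ‖A 0 j ω‖ₑ) :=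
    ((h.identDistrib_A k j).comp measurable_enorm).map_eq
  have hZeq : P.map (fun ω => ‖Z i ω‖ₑ) = P.map (fun ω => ‖Z 0 ω‖ₑ) :=
    ((h.identDistrib_Z i).comp measurable_enorm).map_eq
  rw [← lintegral_map (f := F) hF ((hA k).prodMk (hZ i)),
    hind.map_prod_eq_prod_map_map (hA k).aemeasurable (hZ i).aemeasurable, hAeq, hZeq,
    lintegral_prod _ hF.aemeasurable, lintegral_map hF.lintegral_prod_right' (hA 0)]
  exact lintegral_congr fun ω => lintegral_map (hF.comp measurable_prodMk_left) (hZ 0)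

/-- After subadditivity only the individual laws remain, so the joint law of the diagonal is
irrelevant: `A_{j,j}` has the law of `A_{0,j}`. -/
theorem Hypotheses.absSummA (h : Hypotheses P A Z μ α γ) (hα1 : α ≤ 1) : AbsSummA P A α := by
  have hα := h.regularlyVarying.index_pos
  have hA : ∀ j, Measurable fun ω => ‖A j j ω‖ₑ := fun j =>
    (h.measurable_A j j).enorm
  refine lt_of_le_of_lt ?_ (h.moment.tsum_rpow_index_lt_top (h.measurable_A 0) hα hα1)
  calc ∫⁻ ω, (∑' j : ℤ, ‖A j j ω‖ₑ) ^ α ∂P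
      ≤ ∫⁻ ω, ∑' j : ℤ, ‖A j j ω‖ₑ ^ α ∂P :=
        lintegral_mono fun ω => ennreal_rpow_tsum_le _ hα hα1
    _ = ∑' j : ℤ, ∫⁻ ω, ‖A j j ω‖ₑ ^ α ∂P :=
        lintegral_tsum fun j => ((hA j).pow_const α).aemeasurable
    _ = ∑' j : ℤ, ∫⁻ ω, ‖A 0 j ω‖ₑ ^ α ∂P := tsum_congr fun j =>
        ((h.identDistrib_A j j).comp (measurable_enorm.pow_const α)).lintegral_eq

/-- With `β < α ≤ 1`, independence factors the `β`-th moments, so the `β`-th powers of the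
dominating terms have a finite expected sum; as `β ≤ 1`, the terms themselves are then summable. -/
theorem Hypotheses.ae_summable_term (h : Hypotheses P A Z μ α γ) (hα1 : α ≤ 1) (k : ℤ) :
    ∀ᵐ ω ∂P, Summable fun j : ℤ => ‖term A Z k j ω‖ := by
  have hα := h.regularlyVarying.index_pos
  obtain ⟨β, hβ, hβα, hsum⟩ := h.moment.exists_tsum_lt_top (h.measurable_A 0) hα hα1
  have hZβ := h.regularlyVarying.lintegral_enorm_rpow_lt_top (h.measurable_Z 0) hβ hβα
  have hmeas : ∀ j, Measurable fun ω => (‖A k j ω‖ₑ * ‖Z (k - j) ω‖ₑ) ^ β := fun j =>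
    ((h.measurable_A k j).enorm.mul (h.measurable_Z _).enorm).pow_const β
  have hfin : ∫⁻ ω, ∑' j, (‖A k j ω‖ₑ * ‖Z (k - j) ω‖ₑ) ^ β ∂P ≠ ⊤ := by
    rw [lintegral_tsum fun j => (hmeas j).aemeasurable]
    have hF : Measurable fun q : ℝ≥0∞ × ℝ≥0∞ => (q.1 * q.2) ^ β :=
      (measurable_fst.mul measurable_snd).pow_const β
    have hterm : ∀ j, ∫⁻ ω, (‖A k j ω‖ₑ * ‖Z (k - j) ω‖ₑ) ^ β ∂P =
        (∫⁻ ω, ‖A 0 j ω‖ₑ ^ β ∂P) * ∫⁻ ω, ‖Z 0 ω‖ₑ ^ β ∂P := fun j => by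
      rw [h.lintegral_comp_enorm hF k j (k - j), ← lintegral_mul_const _
        ((h.measurable_A 0 j).enorm.pow_const β)]
      refine lintegral_congr fun ω => ?_
      simp only [ENNReal.mul_rpow_of_nonneg _ _ hβ.le]
      exact lintegral_const_mul _ ((h.measurable_Z 0).enorm.pow_const β)
    rw [tsum_congr hterm, ENNReal.tsum_mul_right]
    exact (ENNReal.mul_lt_top hsum hZβ).ne
  filter_upwards [ae_lt_top (Measurable.tsum hmeas) hfin] with ω hω
  refine tsum_enorm_ne_top_iff_summable_norm.1 (ne_top_of_le_ne_top ?_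
    (ENNReal.tsum_le_tsum fun j => enorm_term_le A Z k j ω))
  intro htop
  have := (ennreal_rpow_tsum_le (fun j => ‖A k j ω‖ₑ * ‖Z (k - j) ω‖ₑ) hβ
    (by linarith)).trans_lt hω
  rw [htop, ENNReal.top_rpow_of_pos hβ] at this
  exact lt_irrefl _ this

/-- The truncated first moments of the process are bounded by the tail of the noise. -/
theorem Hypotheses.exists_lintegral_tsum_min_le (h : Hypotheses P A Z μ α γ) (hα1 : α < 1) :
    ∃ K : ℝ → ℝ≥0∞, Tendsto K (𝓝[>] 0) (𝓝 0) ∧ ∃ u₀ : ℝ, 0 < u₀ ∧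
      ∀ u, u₀ ≤ u → ∀ ε, 0 < ε → ∀ k : ℤ,
        ∫⁻ ω, ∑' j, min (‖A k j ω‖ₑ * ‖Z (k - j) ω‖ₑ) (ENNReal.ofReal (u * ε)) ∂P ≤
          ENNReal.ofReal (u * tail P (Z 0) u) * K ε := by
  have hα := h.regularlyVarying.index_pos
  obtain ⟨ε₀, hε₀, hε₀α, hmom⟩ := h.moment.exists_forall_tsum_lt_top (h.measurable_A 0) hα hα1
  -- The first bound keeps `α ± η` within the range of the moment condition, the second keeps `α + η
  -- < 1` so that both powers of `ε` in `K` are positive.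
  set η := min ε₀ ((1 - α) / 2)
  have hη : 0 < η := lt_min hε₀ (by linarith)
  have hηε : η ≤ ε₀ := min_le_left _ _
  have hη1 : α + η < 1 := by have : η ≤ (1 - α) / 2 := min_le_right _ _; linarith
  obtain ⟨C, u₀, hC, hu₀, hbound⟩ := h.regularlyVarying.exists_lintegral_min_le (h.measurable_Z 0)
    hη (by linarith) hη1
  have hM : ∀ s, α - ε₀ ≤ s → s ≤ α + ε₀ → ∑' j, ∫⁻ ω, ‖A 0 j ω‖ₑ ^ s ∂P ≠ ⊤ :=
    fun s hs hs' => (hmom s hs hs').ne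
  set M : ℝ → ℝ≥0∞ := fun s => ∑' j, ∫⁻ ω, ‖A 0 j ω‖ₑ ^ s ∂P
  refine ⟨fun ε => ENNReal.ofReal C * (M (α - η) * ENNReal.ofReal (ε ^ (1 - (α - η))) +
    M (α + η) * ENNReal.ofReal (ε ^ (1 - (α + η)))), ?_, u₀, hu₀, fun u hu ε hε k => ?_⟩
  · have hpow : ∀ s : ℝ, 0 < s → Tendsto (fun ε : ℝ => ENNReal.ofReal (ε ^ s)) (𝓝[>] 0) (𝓝 0) := by
      intro s hs
      have h0 : Tendsto (fun ε : ℝ => ε ^ s) (𝓝[>] 0) (𝓝 0) := by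
        have : ContinuousAt (fun ε : ℝ => ε ^ s) 0 := Real.continuousAt_rpow_const 0 s (Or.inr hs.le)
        simpa [ContinuousAt, Real.zero_rpow hs.ne'] using this.tendsto.mono_left nhdsWithin_le_nhds
      simpa using ENNReal.tendsto_ofReal h0
    have h1 := ENNReal.Tendsto.const_mul (hpow (1 - (α - η)) (by linarith))
      (Or.inr (hM (α - η) (by linarith) (by linarith)))
    have h2 := ENNReal.Tendsto.const_mul (hpow (1 - (α + η)) (by linarith))
      (Or.inr (hM (α + η) (by linarith) (by linarith)))
    simpa using ENNReal.Tendsto.const_mul (h1.add h2) (Or.inr (ENNReal.ofReal_ne_top (r := C)))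
  · have hu0 : 0 < u := hu₀.trans_le hu
    have hT := tail_nonneg (P := P) (Z := Z 0) u
    have hF : Measurable fun q : ℝ≥0∞ × ℝ≥0∞ => min (q.1 * q.2) (ENNReal.ofReal (u * ε)) :=
      (measurable_fst.mul measurable_snd).min measurable_const
    have hA : ∀ (j : ℤ) (s : ℝ), Measurable fun ω => ‖A 0 j ω‖ₑ ^ s := fun j s =>
      (h.measurable_A 0 j).enorm.pow_const s
    have hterm : ∀ j, ∫⁻ ω, min (‖A k j ω‖ₑ * ‖Z (k - j) ω‖ₑ) (ENNReal.ofReal (u * ε)) ∂P ≤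
        ENNReal.ofReal (u * tail P (Z 0) u) * (ENNReal.ofReal C *
          ((∫⁻ ω, ‖A 0 j ω‖ₑ ^ (α - η) ∂P) * ENNReal.ofReal (ε ^ (1 - (α - η))) +
            (∫⁻ ω, ‖A 0 j ω‖ₑ ^ (α + η) ∂P) * ENNReal.ofReal (ε ^ (1 - (α + η))))) := by
      intro j
      rw [h.lintegral_comp_enorm hF k j (k - j), ← lintegral_mul_const _ (hA j _),
        ← lintegral_mul_const _ (hA j _), ← lintegral_add_left ((hA j _).mul_const _),
        ← lintegral_const_mul _ (((hA j _).mul_const _).fun_add ((hA j _).mul_const _)),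
        ← lintegral_const_mul _
          ((((hA j _).mul_const _).fun_add ((hA j _).mul_const _)).const_mul _)]
      refine lintegral_mono fun ω => ?_
      have hb := hbound u hu ε hε ‖A 0 j ω‖ (norm_nonneg _)
      have hl : ∀ ω', min (‖A 0 j ω‖ₑ * ‖Z 0 ω'‖ₑ) (ENNReal.ofReal (u * ε)) =
          ENNReal.ofReal (min (‖A 0 j ω‖ * ‖Z 0 ω'‖) (u * ε)) := fun ω' => by
        rw [ENNReal.ofReal_min, ENNReal.ofReal_mul (norm_nonneg _), ofReal_norm, ofReal_norm]
      simp only [hl]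
      refine hb.trans_eq ?_
      have hs : ∀ s t : ℝ, 0 ≤ s → ENNReal.ofReal (‖A 0 j ω‖ ^ s * ε ^ t) =
          ‖A 0 j ω‖ₑ ^ s * ENNReal.ofReal (ε ^ t) := fun s t hs => by
        rw [ENNReal.ofReal_mul (by positivity),
          ← ENNReal.ofReal_rpow_of_nonneg (norm_nonneg _) hs, ofReal_norm]
      rw [ENNReal.ofReal_mul (by positivity), ENNReal.ofReal_mul hC.le,
        ENNReal.ofReal_add (by positivity) (by positivity), hs _ _ (by linarith),
        hs _ _ (by linarith)]
      ring
    rw [lintegral_tsum fun j => (((h.measurable_A k j).enorm.fun_mul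
      (h.measurable_Z _).enorm).min measurable_const).aemeasurable]
    refine (ENNReal.tsum_le_tsum hterm).trans_eq ?_
    rw [ENNReal.tsum_mul_left, ENNReal.tsum_mul_left, ENNReal.tsum_add, ENNReal.tsum_mul_right,
      ENNReal.tsum_mul_right]

theorem rate_eq (n : ℕ) : rate P Z γ n = (ENNReal.ofReal (n * tail P (Z 0) (γ n)))⁻¹ := by
  rw [rate, ENNReal.ofReal_mul (Nat.cast_nonneg n), ENNReal.ofReal_natCast, ofReal_tail]

/-- Markov's inequality gives `n γ_n P(|Z| > γ_n) K(ε) / (γ_n δ)`. The factor `r_n` cancels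
everything that depends on `n`, leaving `K(ε)/δ`. -/
theorem Hypotheses.absSmallJump (h : Hypotheses P A Z μ α γ) (hα1 : α < 1) :
    AbsSmallJump P A Z γ := by
  intro δ hδ
  obtain ⟨K, hK, u₀, hu₀, hbound⟩ := h.exists_lintegral_tsum_min_le hα1
  have htail := h.regularlyVarying.tail_pos (h.measurable_Z 0)
  have hγ : Tendsto γ atTop atTop :=
    h.normalizing.tendsto_atTop h.measurable_Z h.iIndep_Z h.identDistrib_Z htail
  have hlim : Tendsto (fun ε => ENNReal.ofReal δ⁻¹ * K ε) (𝓝[>] 0) (𝓝 0) := by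
    simpa using ENNReal.Tendsto.const_mul hK (Or.inr (ENNReal.ofReal_ne_top (r := δ⁻¹)))
  refine tendsto_of_tendsto_of_tendsto_of_le_of_le' tendsto_const_nhds hlim
    (Eventually.of_forall fun _ => zero_le) ?_
  filter_upwards [self_mem_nhdsWithin] with ε hε
  have hε : 0 < ε := hε
  refine limsup_le_of_le (by isBoundedDefault) ?_
  filter_upwards [hγ.eventually_ge_atTop u₀, eventually_ge_atTop 1] with n hn hn1
  have hγ0 : 0 < γ n := hu₀.trans_le hn
  have hT := htail (γ n)
  have hn0 : (0 : ℝ) < n := by exact_mod_cast hn1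
  set W : ℤ → Ω → ℝ≥0∞ := fun k ω =>
    ∑' j, min (‖A k j ω‖ₑ * ‖Z (k - j) ω‖ₑ) (ENNReal.ofReal (γ n * ε))
  have hW : ∀ k, Measurable (W k) := fun k => Measurable.tsum fun j =>
    ((h.measurable_A k j).enorm.mul (h.measurable_Z _).enorm).min
      measurable_const
  have hδγ : 0 < γ n * δ := mul_pos hγ0 hδ
  have hmarkov : P {ω | γ n * δ < ∑ k ∈ Finset.Icc 1 n, ‖truncate (γ n * ε) (X A Z (k : ℤ) ω)‖} ≤
      (n * (ENNReal.ofReal (γ n * tail P (Z 0) (γ n)) * K ε)) / ENNReal.ofReal (γ n * δ) := by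
    calc _ ≤ P {ω | ENNReal.ofReal (γ n * δ) ≤ ∑ k ∈ Finset.Icc 1 n, W (k : ℤ) ω} := by
          refine measure_mono (Set.ofPred_subset_ofPred.2 fun ω hω => ?_)
          refine (ENNReal.ofReal_le_ofReal hω.le).trans ?_
          rw [ENNReal.ofReal_sum_of_nonneg fun _ _ => norm_nonneg _]
          refine Finset.sum_le_sum fun k _ => ?_
          rw [ofReal_norm]
          exact enorm_truncate_X_le A Z _ k ω
      _ ≤ (∫⁻ ω, ∑ k ∈ Finset.Icc 1 n, W (k : ℤ) ω ∂P) / ENNReal.ofReal (γ n * δ) :=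
          meas_ge_le_lintegral_div (Finset.measurable_fun_sum _ fun (k : ℕ) _ => hW k).aemeasurable
            (ENNReal.ofReal_pos.2 hδγ).ne' ENNReal.ofReal_ne_top
      _ ≤ _ := by
          gcongr
          rw [lintegral_finsetSum _ fun (k : ℕ) _ => hW k]
          refine (Finset.sum_le_sum fun (k : ℕ) _ => hbound (γ n) hn ε hε k).trans_eq ?_
          simp
  calc _ ≤ (ENNReal.ofReal (n * tail P (Z 0) (γ n)))⁻¹ *
        ((n * (ENNReal.ofReal (γ n * tail P (Z 0) (γ n)) * K ε)) / ENNReal.ofReal (γ n * δ)) := by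
        rw [rate_eq]; gcongr
    _ = ENNReal.ofReal δ⁻¹ * K ε := by
        have hreal : δ⁻¹ = (n * tail P (Z 0) (γ n))⁻¹ *
            (n * (γ n * tail P (Z 0) (γ n)) * (γ n * δ)⁻¹) := by
          field_simp
        rw [hreal, ENNReal.ofReal_mul (inv_nonneg.2 (by positivity)),
          ENNReal.ofReal_mul (q := (γ n * δ)⁻¹) (by positivity),
          ENNReal.ofReal_mul (q := γ n * tail P (Z 0) (γ n)) hn0.le,
          ENNReal.ofReal_inv_of_pos (by positivity), ENNReal.ofReal_inv_of_pos hδγ,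
          ENNReal.ofReal_natCast, div_eq_mul_inv]
        ring

end Hypotheses

end SmallJumps

end RandomCoefficientProcess

open RandomCoefficientProcess in
theorem proposition6p2 {Ω : Type*} [MeasurableSpace Ω] (P : Measure Ω) [IsProbabilityMeasure P]
    {d p : ℕ} (A : ℤ → ℤ → Ω → Mat d p) (Z : ℤ → Ω → Vec p) (μ : Measure (Vec p))
    (α : ℝ) (γ : ℕ → ℝ) (h : Hypotheses P A Z μ α γ) :
    (α < 1 → AbsSmallJump P A Z γ ∧ SmallJump P A Z γ) ∧
    (α ≤ 1 → AbsSummA P A α ∧ SummA P A α) ∧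
    -- the series defining the process is meaningful in the range considered
    (α ≤ 1 → ∀ k : ℤ, ∀ᵐ ω ∂P, Summable fun j : ℤ => ‖term A Z k j ω‖) :=
  ⟨fun hα1 => ⟨h.absSmallJump hα1, smallJump_of_absSmallJump (h.absSmallJump hα1)⟩,
    fun hα1 => ⟨h.absSummA hα1, summA_of_absSummA h.regularlyVarying.index_pos
      (fun j => h.measurable_A j j) (h.absSummA hα1)⟩,
    fun hα1 k => h.ae_summable_term hα1 k⟩
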